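/- Consider a server with $R$ resource types of capacities $P_1,\dots,P_R$ and $K$ job types; a type-$j$ job demands resources $D_j\in\mathbb{R}_{\ge 0}^R$, has an exponential service requirement of rate $\mu_j>0$, and type-$j$ jobs arrive as a Poisson process of rate $\lambda_j$. A possible schedule is a vector $u\in\mathbb{Z}_{\ge 0}^K$ with $\sum_j u_jD_j\le P$. An MSR policy $p$ consists of an irreducible continuous-time Markov chain $m^p(t)$ (the modulating process) on $\{1,\dots,N\}$, with infinitesimal generator $G$ and stationary distribution $\pi$, and of a possible schedule $(u_{s,1},\dots,u_{s,K})$ for each state $s$. Fix a job type $i$. The corresponding MSR-1 system is the single-server queue with Poisson arrivals of rate $\lambda_i$ and the same modulating process, in which jobs are completed at rate $r_s=\mu_iu_{s,i}$ while $m^p(t)=s$. Let $C(t)$ be its number of potential completions by time $t$, i.e. of those completions that occur if the server never idles: $C$ is a simple counting process with stochastic intensity $r_{m^p(t)}$. (It need not be conditionally independent of $m^p$: the modulating process may change its state at completions or arrivals.) Put $\mathbb{E}[u_i]=\sum_s\pi_sr_s$. **Lemma.** For every state $s$ the relative completions $$\Delta(s)=\lim_{t\to\infty}\bigl(\mathbb{E}[C(t)\mid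 m^p(0)=s]-\mathbb{E}[u_i]\,t\bigr)$$ exist as a finite limit (and $\mathbb{E}[C(t)\mid m^p(0)=s]<\infty$ for all $t\ge0$), and the vector $\Delta=(\Delta(1),\dots,\Delta(N))^T$ is the unique solution $x\in\mathbb{R}^N$ of $$G\,x=\mathbb{E}[u_i]\,\mathbf{1}-(r_1,\dots,r_N)^T,\qquad \sum_{s}\pi_s\,x_s=0 .$$ In particular $\mathbb{E}[\Delta(m^p)]=0$, where $m^p$ has the stationary distribution $\pi$. -/

import Mathlib

open MeasureTheory ProbabilityTheory Filter Topology
open scoped NNReal Matrix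

noncomputable section

/-- A multiresource job model with `K` job types and `R` resource types: server capacities, the
resource demand vector of each job type, the parameter of the exponential service requirement of
each job type, and the Poisson arrival rate of each job type. -/
structure MultiresourceModel (K R : ℕ) where
  capacity : Fin R → ℝ
  demand : Fin K → Fin R → ℝ
  demand_nonneg : ∀ i j, 0 ≤ demand i j
  serviceRate : Fin K → ℝ
  serviceRate_pos : ∀ i, 0 < serviceRate i
  arrivalRate : Fin K → ℝ≥0

/-- The schedulable set: the vectors `u` such that `u i` jobs of type `i`, for all `i`, can be
served in parallel without exceeding any resource capacity. -/
def MultiresourceModel.schedulableSet {K R : ℕ} (M : MultiresourceModel K R) :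
    Set (Fin K → ℕ) :=
  {u | ∀ j, ∑ i, (u i : ℝ) * M.demand i j ≤ M.capacity j}

/-- `G` is the infinitesimal generator of a continuous-time Markov chain on `Fin N`. -/
structure IsGenerator {N : ℕ} (G : Matrix (Fin N) (Fin N) ℝ) : Prop where
  offDiag_nonneg : ∀ s s', s ≠ s' → 0 ≤ G s s'
  row_sum : ∀ s, ∑ s', G s s' = 0

/-- The chain with generator `G` is irreducible: any state leads to any other state through
transitions of positive rate. -/
def IsIrreducibleGenerator {N : ℕ} (G : Matrix (Fin N) (Fin N) ℝ) : Prop :=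
  ∀ s s', Relation.ReflTransGen (fun a b => 0 < G a b) s s'

/-- `π` is a stationary distribution of the chain with generator `G`. -/
structure IsStationaryDistribution {N : ℕ} (G : Matrix (Fin N) (Fin N) ℝ)
    (π : Fin N → ℝ) : Prop where
  nonneg : ∀ s, 0 ≤ π s
  sum_eq_one : ∑ s, π s = 1
  balance : π ᵥ* G = 0

/-- A Markovian service rate (MSR) policy with `N` states: the generator of its irreducible
modulating chain, and the possible schedule that each state of the chain stands for. -/
structure MSRPolicy {K R : ℕ} (M : MultiresourceModel K R) (N : ℕ) where
  generator : Matrix (Fin N) (Fin N) ℝ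
  isGenerator : IsGenerator generator
  irreducible : IsIrreducibleGenerator generator
  schedule : Fin N → Fin K → ℕ
  schedule_mem : ∀ s, schedule s ∈ M.schedulableSet

namespace MSRPolicy

variable {K R N : ℕ} {M : MultiresourceModel K R}

/-- The rate `μ_i u_{s,i}` at which the MSR-1 system for type-`i` jobs completes jobs while the
modulating process is in state `s`. -/
def completionRate (p : MSRPolicy M N) (i : Fin K) (s : Fin N) : ℝ :=
  M.serviceRate i * (p.schedule s i : ℝ)

/-- The steady-state average completion rate of the MSR-1 system for type-`i` jobs, where `π` is
the stationary distribution of the modulating process. -/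
def meanCompletionRate (p : MSRPolicy M N) (i : Fin K) (π : Fin N → ℝ) : ℝ :=
  ∑ s, π s * p.completionRate i s

end MSRPolicy

/-- A path of a simple counting process: it starts at `0`, is nondecreasing and right-continuous,
and has jumps of size one. -/
structure IsCountingPath (c : ℝ≥0 → ℕ) : Prop where
  zero : c 0 = 0
  mono : Monotone c
  right_cont : ∀ t, ∀ᶠ x in 𝓝[>] t, c x = c t
  jump_le_one : ∀ t, ∀ᶠ x in 𝓝[<] t, c t ≤ c x + 1

/-- The MSR-1 system for type-`i` jobs that corresponds to the MSR policy `p`: a single-server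
queue with Poisson arrivals whose service rate is modulated by the modulating process of `p`.
`law s` is the law of the system given that the modulating process starts in state `s`.

The process `completions` counts the potential completions, those that happen if the server never
idles; the actual completions and the queue length are derived from it below. Potential completions
form a simple counting process whose stochastic intensity at time `t` is the completion rate of the
current modulating state, with respect to a filtration that carries all the processes. Neither
completions nor arrivals are required to be conditionally independent of the modulating process,
since the modulating process may change its state at arrivals or completions. -/
structure MSR1System {K R N : ℕ} {M : MultiresourceModel K R} (p : MSRPolicy M N) (i : Fin K)
    (Ω : Type*) [MeasurableSpace Ω] where
  filtration : Filtration ℝ≥0 (inferInstance : MeasurableSpace Ω)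
  law : Fin N → Measure Ω
  law_prob : ∀ s, IsProbabilityMeasure (law s)
  /-- The modulating process: a right-continuous Markov chain with generator `p.generator`. -/
  modulating : ℝ≥0 → Ω → Fin N
  modulating_adapted : Adapted filtration modulating
  modulating_right_cont : ∀ ω t, ∀ᶠ x in 𝓝[>] t, modulating x ω = modulating t ω
  modulating_start : ∀ s, ∀ᵐ ω ∂(law s), modulating 0 ω = s
  modulating_markov : ∀ (s : Fin N) (t h : ℝ≥0) (s' : Fin N),
    (law s)[({ω | modulating (t + h) ω = s'}).indicator (fun _ => (1 : ℝ)) | filtration t]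
      =ᵐ[law s] fun ω => NormedSpace.exp ((h : ℝ) • p.generator) (modulating t ω) s'
  /-- The number of potential completions by time `t`. -/
  completions : ℝ≥0 → Ω → ℕ
  completions_adapted : Adapted filtration completions
  completions_path : ∀ ω, IsCountingPath (fun t => completions t ω)
  completions_intensity : ∀ s, Martingale
    (fun (t : ℝ≥0) ω => (completions t ω : ℝ) -
      ∫ x in (0 : ℝ)..t, p.completionRate i (modulating x.toNNReal ω))
    filtration (law s)
  /-- The number of arrivals by time `t`: a Poisson process of rate `λ_i`. -/
  arrivals : ℝ≥0 → Ω → ℕ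
  arrivals_adapted : Adapted filtration arrivals
  arrivals_path : ∀ ω, IsCountingPath (fun t => arrivals t ω)
  arrivals_law : ∀ (s : Fin N) (t h : ℝ≥0),
    (law s).map (fun ω => arrivals (t + h) ω - arrivals t ω)
      = poissonMeasure (M.arrivalRate i * h)
  arrivals_indep : ∀ (s : Fin N) (t h : ℝ≥0),
    Indep (MeasurableSpace.comap (fun ω => arrivals (t + h) ω - arrivals t ω) ⊤)
      (filtration t) (law s)
  initialQueue : Ω → ℕ
  initialQueue_measurable : Measurable[filtration 0] initialQueue

namespace MSR1System

variable {K R N : ℕ} {M : MultiresourceModel K R} {p : MSRPolicy M N} {i : Fin K}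
  {Ω : Type*} [MeasurableSpace Ω]

/-- The unused service by time `t`: the number of potential completions that find an empty queue.
The subtraction of natural numbers is the positive part. -/
def unusedService (X : MSR1System p i Ω) (t : ℝ≥0) (ω : Ω) : ℕ :=
  ⨆ x : Set.Iic t, (X.completions x ω - (X.initialQueue ω + X.arrivals x ω))

/-- The actual completions by time `t`: potential completions minus unused service. -/
def actualCompletions (X : MSR1System p i Ω) (t : ℝ≥0) (ω : Ω) : ℕ :=
  X.completions t ω - X.unusedService t ω

/-- The number of jobs in the MSR-1 system at time `t`. -/
def queueLength (X : MSR1System p i Ω) (t : ℝ≥0) (ω : Ω) : ℕ :=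
  X.initialQueue ω + X.arrivals t ω - X.actualCompletions t ω

/-- The quantity `E[C(t) | m(0) = s] - E[u] t` whose limit is the relative completions of `s`;
`π` is the stationary distribution of the modulating process. -/
def excessCompletions (X : MSR1System p i Ω) (π : Fin N → ℝ) (s : Fin N) (t : ℝ≥0) : ℝ :=
  (∫ ω, (X.completions t ω : ℝ) ∂(X.law s)) - p.meanCompletionRate i π * t

/-- The relative completions `Δ(s) = lim_{t → ∞} (E[C(t) | m(0) = s] - E[u] t)`. -/
def relativeCompletions (X : MSR1System p i Ω) (π : Fin N → ℝ) (s : Fin N) : ℝ :=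
  limUnder atTop (X.excessCompletions π s)

end MSR1System

end

/-! Write `r` for the completion rates and `c` for their stationary mean. The compensated count is a
martingale, so the mean of `C(t)` from state `s` is `∫₀ᵗ (exp(yG) r)_s dy`; only the intensity
matters, hence no conditional independence is needed. If `x` solves Poisson's equation `G x = c 1 -
r`, the integrand is the derivative of `c y - (exp(yG) x)_s`, so the excess equals `x_s - (exp(tG)
x)_s` exactly. When `π · x = 0`, ergodicity (`IsGenerator.tendsto_exp_mulVec`) sends the last term
to `0`.

Thus every normalized solution is the limit, which gives uniqueness; existence
(`IsGenerator.exists_mulVec_eq`) is linear algebra in finite dimension. -/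

section Generator

/-! ### Matrix exponentials and their entries -/

variable {n : Type*} [Fintype n] [DecidableEq n]

open scoped Matrix.Norms.Operator in
theorem hasDerivAt_exp_smul_mulVec (G : Matrix n n ℝ) (v : n → ℝ) (t : ℝ) :
    HasDerivAt (fun t : ℝ => NormedSpace.exp (t • G) *ᵥ v)
      (NormedSpace.exp (t • G) *ᵥ (G *ᵥ v)) t := by
  rw [Matrix.mulVec_mulVec]
  exact (LinearMap.toContinuousLinearMap
    ((Matrix.mulVecBilin ℝ ℝ).flip v)).hasFDerivAt.comp_hasDerivAt t
      (hasDerivAt_exp_smul_const (𝕂 := ℝ) G t)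

open scoped Matrix.Norms.Operator in
theorem hasDerivAt_vecMul_exp_smul (G : Matrix n n ℝ) (v : n → ℝ) (t : ℝ) :
    HasDerivAt (fun t : ℝ => v ᵥ* NormedSpace.exp (t • G))
      ((v ᵥ* G) ᵥ* NormedSpace.exp (t • G)) t := by
  rw [Matrix.vecMul_vecMul]
  exact (LinearMap.toContinuousLinearMap
    (Matrix.vecMulBilin ℝ ℝ v)).hasFDerivAt.comp_hasDerivAt t
      (hasDerivAt_exp_smul_const' (𝕂 := ℝ) G t)

theorem exp_smul_mulVec_eq_self {G : Matrix n n ℝ} {v : n → ℝ} (h : G *ᵥ v = 0) (t : ℝ) :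
    NormedSpace.exp (t • G) *ᵥ v = v := by
  have hd := hasDerivAt_exp_smul_mulVec G v
  have := is_const_of_deriv_eq_zero (fun t => (hd t).differentiableAt)
    (fun t => by rw [(hd t).deriv, h, Matrix.mulVec_zero]) t 0
  simpa using this

theorem vecMul_exp_smul_eq_self {G : Matrix n n ℝ} {v : n → ℝ} (h : v ᵥ* G = 0) (t : ℝ) :
    v ᵥ* NormedSpace.exp (t • G) = v := by
  have hd := hasDerivAt_vecMul_exp_smul G v
  have := is_const_of_deriv_eq_zero (fun t => (hd t).differentiableAt)
    (fun t => by rw [(hd t).deriv, h, Matrix.zero_vecMul]) t 0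
  simpa using this

theorem exp_add_smul (G : Matrix n n ℝ) (s t : ℝ) :
    NormedSpace.exp ((s + t) • G) = NormedSpace.exp (s • G) * NormedSpace.exp (t • G) := by
  rw [add_smul, Matrix.exp_add_of_commute]
  exact ((Commute.refl G).smul_left s).smul_right t

theorem pow_apply_nonneg {A : Matrix n n ℝ} (hA : ∀ a b, 0 ≤ A a b) (k : ℕ) (a b : n) :
    0 ≤ (A ^ k) a b := by
  induction k generalizing a b with
  | zero => rw [pow_zero, Matrix.one_apply]; split_ifs <;> norm_num
  | succ k ih =>
    rw [pow_succ, Matrix.mul_apply]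
    exact Finset.sum_nonneg fun j _ => mul_nonneg (ih a j) (hA j b)

open scoped Matrix.Norms.Operator in
theorem hasSum_exp_apply (A : Matrix n n ℝ) (a b : n) :
    HasSum (fun k : ℕ => ((k.factorial : ℝ)⁻¹) * (A ^ k) a b) (NormedSpace.exp A a b) :=
  (NormedSpace.exp_series_hasSum_exp' (𝕂 := ℝ) A).map
    (Matrix.entryLinearMap ℝ ℝ a b : Matrix n n ℝ →ₗ[ℝ] ℝ)
    (LinearMap.continuous_of_finiteDimensional _)

theorem le_exp_apply {A : Matrix n n ℝ} (hA : ∀ a b, 0 ≤ A a b) (k : ℕ) (a b : n) :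
    ((k.factorial : ℝ)⁻¹) * (A ^ k) a b ≤ NormedSpace.exp A a b :=
  le_hasSum (hasSum_exp_apply A a b) k fun j _ =>
    mul_nonneg (by positivity) (pow_apply_nonneg hA j a b)

/-- A scalar shift costs only a positive factor, so signs of entries of `exp G` can be read off a
shifted, entrywise nonnegative matrix. -/
theorem exp_add_smul_one (G : Matrix n n ℝ) (c : ℝ) :
    NormedSpace.exp (G + c • (1 : Matrix n n ℝ)) = Real.exp c • NormedSpace.exp G := by
  rw [Matrix.exp_add_of_commute _ _ ((Commute.one_right G).smul_right c)]
  have : NormedSpace.exp (c • (1 : Matrix n n ℝ)) = Real.exp c • (1 : Matrix n n ℝ) := by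
    rw [Matrix.smul_one_eq_diagonal, Matrix.exp_diagonal, Matrix.smul_one_eq_diagonal]
    congr 1
    ext i
    rw [Pi.coe_exp, Real.exp_eq_exp_ℝ]
  rw [this, Matrix.mul_smul, mul_one]

end Generator

/-! ### Irreducible generators: positivity, ergodicity, Poisson's equation -/

namespace IsGenerator

variable {N : ℕ} {G : Matrix (Fin N) (Fin N) ℝ}

theorem smul (hG : IsGenerator G) {t : ℝ} (ht : 0 ≤ t) : IsGenerator (t • G) where
  offDiag_nonneg s s' h := mul_nonneg ht (hG.offDiag_nonneg s s' h)
  row_sum s := by simp [← Finset.mul_sum, hG.row_sum s]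

theorem exists_shift_nonneg (hG : IsGenerator G) :
    ∃ c : ℝ, 0 ≤ c ∧ ∀ a b, 0 ≤ (G + c • (1 : Matrix (Fin N) (Fin N) ℝ)) a b := by
  refine ⟨∑ s, |G s s|, Finset.sum_nonneg fun _ _ => abs_nonneg _, fun a b => ?_⟩
  by_cases h : a = b
  · subst h
    have := Finset.single_le_sum (f := fun s => |G s s|) (fun _ _ => abs_nonneg _)
      (Finset.mem_univ a)
    simp only [Matrix.add_apply, Matrix.smul_apply, Matrix.one_apply_eq, smul_eq_mul, mul_one]
    linarith [neg_abs_le (G a a)]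
  · simpa [Matrix.one_apply_ne h] using hG.offDiag_nonneg a b h

theorem exp_nonneg (hG : IsGenerator G) (a b : Fin N) : 0 ≤ NormedSpace.exp G a b := by
  obtain ⟨c, -, hc⟩ := hG.exists_shift_nonneg
  have h := (mul_nonneg (by positivity) (pow_apply_nonneg hc 0 a b)).trans (le_exp_apply hc 0 a b)
  rw [exp_add_smul_one, Matrix.smul_apply, smul_eq_mul] at h
  exact nonneg_of_mul_nonneg_right h (Real.exp_pos c)

theorem exp_pos (hG : IsGenerator G) (hirr : IsIrreducibleGenerator G) (a b : Fin N) :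
    0 < NormedSpace.exp G a b := by
  obtain ⟨c, hc0, hc⟩ := hG.exists_shift_nonneg
  -- The exponent is the length of a path of positive-rate transitions from `a` to `b`.
  have hpow : ∃ k : ℕ, 0 < ((G + c • (1 : Matrix (Fin N) (Fin N) ℝ)) ^ k) a b := by
    induction hirr a b with
    | refl => exact ⟨0, by simp⟩
    | @tail b d _ hbd ih =>
      obtain ⟨k, hk⟩ := ih
      refine ⟨k + 1, ?_⟩
      rw [pow_succ, Matrix.mul_apply]
      refine Finset.sum_pos' (fun j _ => mul_nonneg (pow_apply_nonneg hc k a j) (hc j d))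
        ⟨b, Finset.mem_univ b, mul_pos hk ?_⟩
      have : 0 ≤ (c • (1 : Matrix (Fin N) (Fin N) ℝ)) b d := by
        rw [Matrix.smul_apply, Matrix.one_apply]
        split_ifs <;> simp [hc0]
      rw [Matrix.add_apply]
      linarith
  obtain ⟨k, hk⟩ := hpow
  have h := (mul_pos (by positivity) hk).trans_le (le_exp_apply hc k a b)
  rw [exp_add_smul_one, Matrix.smul_apply, smul_eq_mul] at h
  exact pos_of_mul_pos_right h (Real.exp_pos c).le

theorem mulVec_const (hG : IsGenerator G) (c : ℝ) : G *ᵥ (fun _ => c) = 0 := by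
  ext s
  simp [Matrix.mulVec, dotProduct, ← Finset.sum_mul, hG.row_sum s]

theorem exp_row_sum (hG : IsGenerator G) (a : Fin N) : ∑ b, NormedSpace.exp G a b = 1 := by
  have h := congrFun (exp_smul_mulVec_eq_self (hG.mulVec_const 1) 1) a
  simpa [Matrix.mulVec, dotProduct] using h

theorem norm_exp_mulVec_le (hG : IsGenerator G) (v : Fin N → ℝ) :
    ‖NormedSpace.exp G *ᵥ v‖ ≤ ‖v‖ := by
  refine (pi_norm_le_iff_of_nonneg (norm_nonneg v)).2 fun a => ?_
  calc ‖∑ b, NormedSpace.exp G a b * v b‖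
      ≤ ∑ b, NormedSpace.exp G a b * ‖v‖ := by
        refine norm_sum_le_of_le _ fun b _ => ?_
        rw [norm_mul, Real.norm_of_nonneg (hG.exp_nonneg a b)]
        exact mul_le_mul_of_nonneg_left (norm_le_pi_norm v b) (hG.exp_nonneg a b)
    _ = ‖v‖ := by rw [← Finset.sum_mul, hG.exp_row_sum, one_mul]

/-- Doeblin's condition: the time-one transition matrix of an irreducible chain is a strict
contraction on the vectors of stationary mean zero. -/
theorem exists_contraction (hG : IsGenerator G) (hirr : IsIrreducibleGenerator G)
    {π : Fin N → ℝ} (hπ : IsStationaryDistribution G π) :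
    ∃ ρ : ℝ, 0 ≤ ρ ∧ ρ < 1 ∧ ∀ v : Fin N → ℝ, π ⬝ᵥ v = 0 →
      ‖NormedSpace.exp G *ᵥ v‖ ≤ ρ * ‖v‖ := by
  have hne : Nonempty (Fin N) := by
    by_contra h
    rw [not_nonempty_iff] at h
    simpa using hπ.sum_eq_one
  obtain ⟨q, hq⟩ := Finite.exists_min fun q : Fin N × Fin N => NormedSpace.exp G q.1 q.2
  set ε := NormedSpace.exp G q.1 q.2
  have hε : 0 < ε := hG.exp_pos hirr _ _
  -- Subtracting the rank-one matrix `ε 1πᵀ` keeps entries nonnegative, lowers row sums to `1 - ε`,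
  -- and does not affect vectors of mean zero.
  have hle : ∀ a b, 0 ≤ NormedSpace.exp G a b - ε * π b := fun a b => by
    have h1 : π b ≤ 1 := hπ.sum_eq_one ▸
      Finset.single_le_sum (fun s _ => hπ.nonneg s) (Finset.mem_univ b)
    have := mul_le_mul_of_nonneg_left h1 hε.le
    linarith [hq (a, b)]
  have hsum : ∀ a, ∑ b, (NormedSpace.exp G a b - ε * π b) = 1 - ε := fun a => by
    rw [Finset.sum_sub_distrib, hG.exp_row_sum, ← Finset.mul_sum, hπ.sum_eq_one, mul_one]
  have hρ : 0 ≤ 1 - ε := hsum hne.some ▸ Finset.sum_nonneg fun b _ => hle _ b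
  refine ⟨1 - ε, hρ, by linarith, fun v hv => ?_⟩
  refine (pi_norm_le_iff_of_nonneg (by positivity)).2 fun a => ?_
  have heq : (NormedSpace.exp G *ᵥ v) a = ∑ b, (NormedSpace.exp G a b - ε * π b) * v b := by
    have hv' : ∑ b, π b * v b = 0 := hv
    simp_rw [sub_mul, Finset.sum_sub_distrib, mul_assoc, ← Finset.mul_sum, hv', mul_zero, sub_zero]
    rfl
  rw [heq, ← hsum a, Finset.sum_mul]
  refine norm_sum_le_of_le _ fun b _ => ?_
  rw [norm_mul, Real.norm_of_nonneg (hle a b)]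
  exact mul_le_mul_of_nonneg_left (norm_le_pi_norm v b) (hle a b)

/-- Ergodicity: the transition semigroup of an irreducible chain annihilates, in the limit, the
vectors of stationary mean zero. -/
theorem tendsto_exp_mulVec (hG : IsGenerator G) (hirr : IsIrreducibleGenerator G)
    {π : Fin N → ℝ} (hπ : IsStationaryDistribution G π) {v : Fin N → ℝ} (hv : π ⬝ᵥ v = 0) :
    Tendsto (fun t : ℝ => NormedSpace.exp (t • G) *ᵥ v) atTop (𝓝 0) := by
  obtain ⟨ρ, hρ0, hρ1, hρ⟩ := hG.exists_contraction hirr hπ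
  have hpow : ∀ k : ℕ, ‖NormedSpace.exp ((k : ℝ) • G) *ᵥ v‖ ≤ ρ ^ k * ‖v‖ := fun k => by
    induction k with
    | zero => simp
    | succ k ih =>
      rw [Nat.cast_succ, add_comm, exp_add_smul, one_smul, ← Matrix.mulVec_mulVec, pow_succ',
        mul_assoc]
      refine (hρ _ ?_).trans (mul_le_mul_of_nonneg_left ih hρ0)
      rw [Matrix.dotProduct_mulVec, vecMul_exp_smul_eq_self hπ.balance, hv]
  have hlim : Tendsto (fun t : ℝ => ρ ^ ⌊t⌋₊ * ‖v‖) atTop (𝓝 0) := by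
    simpa using ((tendsto_pow_atTop_nhds_zero_of_lt_one hρ0 hρ1).comp
      (tendsto_nat_floor_atTop (α := ℝ))).mul_const ‖v‖
  refine squeeze_zero_norm' ?_ hlim
  filter_upwards [eventually_ge_atTop 0] with t ht
  have ht' : 0 ≤ t - ⌊t⌋₊ := sub_nonneg.2 (Nat.floor_le ht)
  refine le_trans ?_ (hpow ⌊t⌋₊)
  -- The fractional part of the time contributes a stochastic matrix, which does not increase the
  -- sup norm.
  rw [show t • G = ((t - ⌊t⌋₊) + ⌊t⌋₊) • G by rw [sub_add_cancel], exp_add_smul,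
    ← Matrix.mulVec_mulVec]
  exact (hG.smul ht').norm_exp_mulVec_le _

theorem eq_zero_of_mulVec_eq_zero (hG : IsGenerator G) (hirr : IsIrreducibleGenerator G)
    {π : Fin N → ℝ} (hπ : IsStationaryDistribution G π) {v : Fin N → ℝ} (hGv : G *ᵥ v = 0)
    (hv : π ⬝ᵥ v = 0) : v = 0 := by
  have h := hG.tendsto_exp_mulVec hirr hπ hv
  simp_rw [exp_smul_mulVec_eq_self hGv] at h
  exact tendsto_nhds_unique tendsto_const_nhds h

/-- Poisson's equation for an irreducible generator is solvable. -/
theorem exists_mulVec_eq (hG : IsGenerator G) (hirr : IsIrreducibleGenerator G)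
    {π : Fin N → ℝ} (hπ : IsStationaryDistribution G π) {w : Fin N → ℝ} (hw : π ⬝ᵥ w = 0) :
    ∃ x : Fin N → ℝ, G *ᵥ x = w ∧ π ⬝ᵥ x = 0 := by
  have hπ1 : π ⬝ᵥ 1 = 1 := by simp [dotProduct, hπ.sum_eq_one]
  -- Adding `1πᵀ` removes the kernel of `G`; since `πG = 0`, pairing with `π` shows that `L`
  -- preserves the mean.
  let L : (Fin N → ℝ) →ₗ[ℝ] (Fin N → ℝ) :=
    G.mulVecLin + (dotProductBilin ℝ ℝ π).smulRight (1 : Fin N → ℝ)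
  have hL : ∀ v, L v = G *ᵥ v + (π ⬝ᵥ v) • (1 : Fin N → ℝ) := fun v => rfl
  have hπL : ∀ v, π ⬝ᵥ L v = π ⬝ᵥ v := fun v => by
    rw [hL, dotProduct_add, Matrix.dotProduct_mulVec, hπ.balance, zero_dotProduct, zero_add,
      dotProduct_smul, hπ1, smul_eq_mul, mul_one]
  have hinj : Function.Injective L := (injective_iff_map_eq_zero L).2 fun v hv => by
    have h0 : π ⬝ᵥ v = 0 := by rw [← hπL, hv, dotProduct_zero]
    rw [hL, h0, zero_smul, add_zero] at hv
    exact hG.eq_zero_of_mulVec_eq_zero hirr hπ hv h0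
  obtain ⟨x, hx⟩ := LinearMap.injective_iff_surjective.1 hinj w
  have h0 : π ⬝ᵥ x = 0 := by rw [← hπL, hx, hw]
  rw [hL, h0, zero_smul, add_zero] at hx
  exact ⟨x, hx, h0⟩

end IsGenerator

/-! ### Integration along the semigroup and joint measurability -/

/-- The integral of the semigroup applied to `r` when `x` solves Poisson's equation for `r`. -/
theorem integral_exp_smul_mulVec_apply {n : Type*} [Fintype n] [DecidableEq n]
    {G : Matrix n n ℝ} (hG : G *ᵥ 1 = 0) {x r : n → ℝ} {c : ℝ}
    (hx : G *ᵥ x = c • 1 - r) (s : n) (t : ℝ) :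
    ∫ y in (0 : ℝ)..t, (NormedSpace.exp (y • G) *ᵥ r) s =
      c * t + x s - (NormedSpace.exp (t • G) *ᵥ x) s := by
  have hd : ∀ y : ℝ, HasDerivAt (fun y => c * y - (NormedSpace.exp (y • G) *ᵥ x) s)
      ((NormedSpace.exp (y • G) *ᵥ r) s) y := fun y => by
    have h := ((hasDerivAt_id y).const_mul c).fun_sub
      (hasDerivAt_pi.1 (hasDerivAt_exp_smul_mulVec G x y) s)
    rw [hx, Matrix.mulVec_sub, Matrix.mulVec_smul, exp_smul_mulVec_eq_self hG] at h
    simpa using h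
  have hcont : Continuous fun y : ℝ => (NormedSpace.exp (y • G) *ᵥ r) s :=
    continuous_iff_continuousAt.2 fun y =>
      (hasDerivAt_pi.1 (hasDerivAt_exp_smul_mulVec G r y) s).continuousAt
  rw [intervalIntegral.integral_eq_sub_of_hasDerivAt (fun y _ => hd y)
    (hcont.intervalIntegrable _ _)]
  simp
  ring

/-- A process with right-continuous piecewise constant paths is jointly measurable. -/
theorem measurable_uncurry_of_eventually_eq_nhdsGT {Ω E : Type*} [MeasurableSpace Ω]
    [MeasurableSpace E] {Y : ℝ≥0 → Ω → E} (hY : ∀ t, Measurable (Y t))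
    (hright : ∀ ω t, ∀ᶠ x in 𝓝[>] t, Y x ω = Y t ω) {f : E → ℝ} (hf : Measurable f) :
    Measurable fun q : ℝ≥0 × Ω => f (Y q.1 q.2) := by
  -- The next point of the grid of mesh `1/(k+1)`. The `+ 1` after the floor puts it strictly to the
  -- right of `x`, where the path is eventually constant.
  let φ : ℕ → ℝ≥0 → ℝ≥0 := fun k x => ((⌊((k : ℝ≥0) + 1) * x⌋₊ : ℝ≥0) + 1) / ((k : ℝ≥0) + 1)
  have hpos : ∀ k : ℕ, (0 : ℝ≥0) < (k : ℝ≥0) + 1 := fun k => by positivity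
  have hlt : ∀ k x, x < φ k x := fun k x => by
    rw [lt_div_iff₀ (hpos k), mul_comm]
    exact Nat.lt_floor_add_one _
  have hle : ∀ k x, φ k x ≤ x + 1 / ((k : ℝ≥0) + 1) := fun k x => by
    rw [div_le_iff₀ (hpos k), add_mul x, div_mul_cancel₀ _ (hpos k).ne', mul_comm x]
    gcongr
    exact Nat.floor_le (zero_le)
  have hlim : ∀ x, Tendsto (fun k => φ k x) atTop (𝓝[>] x) := fun x => by
    refine tendsto_nhdsWithin_iff.2 ⟨?_, Eventually.of_forall fun k => hlt k x⟩
    refine tendsto_of_tendsto_of_tendsto_of_le_of_le tendsto_const_nhds ?_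
      (fun k => (hlt k x).le) (fun k => hle k x)
    simpa using (tendsto_one_div_add_atTop_nhds_zero_nat (𝕜 := ℝ≥0)).const_add x
  refine measurable_of_tendsto_metrizable
    (f := fun (k : ℕ) (q : ℝ≥0 × Ω) => f (Y (φ k q.1) q.2)) (fun k => ?_)
    (tendsto_pi_nhds.2 fun q => ?_)
  · have h1 : ∀ ψ : ℕ → ℝ≥0, Measurable fun q : ℕ × Ω => f (Y (ψ q.1) q.2) := fun ψ =>
      measurable_from_prod_countable_right fun j => hf.comp (hY (ψ j))
    have h2 : Measurable fun q : ℝ≥0 × Ω => (⌊((k : ℝ≥0) + 1) * q.1⌋₊, q.2) :=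
      (Nat.measurable_floor.comp (measurable_fst.const_mul _)).prodMk measurable_snd
    simpa only [Function.comp_def] using
      (h1 fun j => ((j : ℝ≥0) + 1) / ((k : ℝ≥0) + 1)).comp h2
  · refine tendsto_const_nhds.congr' ?_
    filter_upwards [(hlim q.1).eventually (hright q.2 q.1)] with k hk
    rw [hk]

/-! ### Expected completions of the MSR-1 system -/

namespace MSR1System

variable {K R N : ℕ} {M : MultiresourceModel K R} {p : MSRPolicy M N} {i : Fin K}
  {Ω : Type*} [MeasurableSpace Ω]

theorem measurable_modulating (X : MSR1System p i Ω) (t : ℝ≥0) : Measurable (X.modulating t) :=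
  (X.modulating_adapted t).mono (X.filtration.le t) le_rfl

theorem measurable_completions (X : MSR1System p i Ω) (t : ℝ≥0) :
    Measurable (X.completions t) :=
  (X.completions_adapted t).mono (X.filtration.le t) le_rfl

theorem integral_indicator_modulating (X : MSR1System p i Ω) (s s' : Fin N) (t : ℝ≥0) :
    ∫ ω, ({ω | X.modulating t ω = s'}).indicator (fun _ => (1 : ℝ)) ω ∂(X.law s) =
      NormedSpace.exp ((t : ℝ) • p.generator) s s' := by
  have := X.law_prob s
  -- The Markov property at time `0`, where the state is almost surely `s`.
  have h := X.modulating_markov s 0 t s'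
  rw [zero_add] at h
  rw [← integral_condExp (X.filtration.le 0), integral_congr_ae h]
  have h' : (fun ω => NormedSpace.exp ((t : ℝ) • p.generator) (X.modulating 0 ω) s') =ᵐ[X.law s]
      fun _ => NormedSpace.exp ((t : ℝ) • p.generator) s s' := by
    filter_upwards [X.modulating_start s] with ω hω
    rw [hω]
  rw [integral_congr_ae h']
  simp

theorem integral_comp_modulating (X : MSR1System p i Ω) (f : Fin N → ℝ) (s : Fin N) (t : ℝ≥0) :
    ∫ ω, f (X.modulating t ω) ∂(X.law s) =
      (NormedSpace.exp ((t : ℝ) • p.generator) *ᵥ f) s := by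
  have := X.law_prob s
  have hm : ∀ s', MeasurableSet {ω | X.modulating t ω = s'} := fun s' =>
    X.measurable_modulating t (measurableSet_singleton s')
  have h : ∀ ω, f (X.modulating t ω) =
      ∑ s', ({ω | X.modulating t ω = s'}).indicator (fun _ => (1 : ℝ)) ω * f s' := fun ω => by
    simp [Set.indicator_apply]
  simp_rw [h]
  rw [integral_finsetSum _ fun s' _ =>
    ((integrable_const (1 : ℝ)).indicator (hm s')).mul_const (f s')]
  simp_rw [integral_mul_const, integral_indicator_modulating]
  rfl

theorem abs_integral_completionRate_le (X : MSR1System p i Ω) (t : ℝ≥0) (ω : Ω) :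
    |∫ x in (0 : ℝ)..t, p.completionRate i (X.modulating x.toNNReal ω)| ≤
      ‖p.completionRate i‖ * t := by
  have := intervalIntegral.norm_integral_le_of_norm_le_const (a := (0 : ℝ)) (b := t)
    (f := fun x => p.completionRate i (X.modulating x.toNNReal ω))
    fun x _ => norm_le_pi_norm (p.completionRate i) _
  simpa using this

theorem integrable_integral_completionRate (X : MSR1System p i Ω) (s : Fin N) (t : ℝ≥0) :
    Integrable (fun ω => ∫ x in (0 : ℝ)..t, p.completionRate i (X.modulating x.toNNReal ω))
      (X.law s) := by
  have := X.law_prob s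
  have hC : AEStronglyMeasurable (fun ω => (X.completions t ω : ℝ)) (X.law s) :=
    (measurable_from_nat.comp (X.measurable_completions t)).aestronglyMeasurable
  -- The compensator is the count minus the martingale, so its measurability needs no Fubini
  -- argument.
  have hI := hC.sub ((X.completions_intensity s).integrable t).aestronglyMeasurable
  refine Integrable.of_bound (C := ‖p.completionRate i‖ * t) (hI.congr ?_)
    (Eventually.of_forall fun ω => X.abs_integral_completionRate_le t ω)
  exact Eventually.of_forall fun ω => by simp

theorem integrable_completions (X : MSR1System p i Ω) (s : Fin N) (t : ℝ≥0) :
    Integrable (fun ω => (X.completions t ω : ℝ)) (X.law s) := by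
  refine (((X.completions_intensity s).integrable t).add
    (X.integrable_integral_completionRate s t)).congr ?_
  exact Eventually.of_forall fun ω => by simp

theorem integral_completions_eq_integral_rate (X : MSR1System p i Ω) (s : Fin N) (t : ℝ≥0) :
    ∫ ω, (X.completions t ω : ℝ) ∂(X.law s) =
      ∫ ω, (∫ x in (0 : ℝ)..t, p.completionRate i (X.modulating x.toNNReal ω)) ∂(X.law s) := by
  have := X.law_prob s
  have h := (X.completions_intensity s).setIntegral_eq (zero_le (a := t)) MeasurableSet.univ
  simp only [Measure.restrict_univ] at h
  rw [integral_sub (X.integrable_completions s t) (X.integrable_integral_completionRate s t)] at h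
  simp only [(X.completions_path _).zero, NNReal.coe_zero, intervalIntegral.integral_same,
    Nat.cast_zero, sub_zero, integral_zero] at h
  linarith

theorem integral_completions (X : MSR1System p i Ω) (s : Fin N) (t : ℝ≥0) :
    ∫ ω, (X.completions t ω : ℝ) ∂(X.law s) =
      ∫ x in (0 : ℝ)..t, (NormedSpace.exp (x • p.generator) *ᵥ p.completionRate i) s := by
  have := X.law_prob s
  have hmeas : Measurable fun q : ℝ × Ω =>
      p.completionRate i (X.modulating q.1.toNNReal q.2) :=
    (measurable_uncurry_of_eventually_eq_nhdsGT X.measurable_modulating X.modulating_right_cont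
      (measurable_of_finite (p.completionRate i))).comp
      ((measurable_real_toNNReal.comp measurable_fst).prodMk measurable_snd)
  rw [integral_completions_eq_integral_rate, ← intervalIntegral_integral_swap]
  · refine intervalIntegral.integral_congr fun x hx => ?_
    rw [Set.uIcc_of_le t.coe_nonneg] at hx
    rw [X.integral_comp_modulating, Real.coe_toNNReal x hx.1]
  · have : IsFiniteMeasure ((volume : Measure ℝ).restrict (Set.uIoc 0 (t : ℝ))) :=
      isFiniteMeasure_restrict.2 (by simp [Set.uIoc])
    exact Integrable.of_bound (C := ‖p.completionRate i‖) hmeas.aestronglyMeasurable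
      (Eventually.of_forall fun q => norm_le_pi_norm (p.completionRate i) _)

theorem tendsto_excessCompletions (X : MSR1System p i Ω) {π : Fin N → ℝ}
    (hπ : IsStationaryDistribution p.generator π) {x : Fin N → ℝ}
    (hx : p.generator *ᵥ x = fun s => p.meanCompletionRate i π - p.completionRate i s)
    (hπx : π ⬝ᵥ x = 0) (s : Fin N) :
    Tendsto (X.excessCompletions π s) atTop (𝓝 (x s)) := by
  have hx' : p.generator *ᵥ x = p.meanCompletionRate i π • 1 - p.completionRate i := by
    rw [hx]; ext s; simp
  have h : ∀ t : ℝ≥0, X.excessCompletions π s t =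
      x s - (NormedSpace.exp ((t : ℝ) • p.generator) *ᵥ x) s := fun t => by
    rw [excessCompletions, integral_completions,
      integral_exp_smul_mulVec_apply (p.isGenerator.mulVec_const 1) hx']
    ring
  rw [funext h]
  have hlim := tendsto_pi_nhds.1
    ((p.isGenerator.tendsto_exp_mulVec p.irreducible hπ hπx).comp
      (NNReal.tendsto_coe_atTop.2 tendsto_id)) s
  simpa using hlim.const_sub (x s)

end MSR1System

theorem mainTheorem9 {K R N : ℕ} {M : MultiresourceModel K R} (p : MSRPolicy M N) (i : Fin K)
    {Ω : Type*} [MeasurableSpace Ω] (X : MSR1System p i Ω)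
    (π : Fin N → ℝ) (hπ : IsStationaryDistribution p.generator π) :
    (∀ s, (∀ t, Integrable (fun ω => (X.completions t ω : ℝ)) (X.law s)) ∧
      Tendsto (X.excessCompletions π s) atTop (𝓝 (X.relativeCompletions π s))) ∧
    ∀ x : Fin N → ℝ,
      ((p.generator *ᵥ x = fun s => p.meanCompletionRate i π - p.completionRate i s) ∧
        ∑ s, π s * x s = 0) ↔ x = X.relativeCompletions π := by
  have hsol : ∀ x : Fin N → ℝ,
      ((p.generator *ᵥ x = fun s => p.meanCompletionRate i π - p.completionRate i s) ∧
        ∑ s, π s * x s = 0) → x = X.relativeCompletions π := fun x hx =>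
    funext fun s => (X.tendsto_excessCompletions hπ hx.1 hx.2 s).limUnder_eq.symm
  obtain ⟨x, hx, hπx⟩ := p.isGenerator.exists_mulVec_eq p.irreducible hπ
    (w := fun s => p.meanCompletionRate i π - p.completionRate i s) (by
      simp only [dotProduct, mul_sub, Finset.sum_sub_distrib, ← Finset.sum_mul, hπ.sum_eq_one,
        one_mul, MSRPolicy.meanCompletionRate, sub_self])
  have hxr := hsol x ⟨hx, hπx⟩
  refine ⟨fun s => ⟨X.integrable_completions s, ?_⟩, fun y => ⟨hsol y, fun hy => ?_⟩⟩
  · rw [← hxr]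
    exact X.tendsto_excessCompletions hπ hx hπx s
  · rw [hy, ← hxr]
    exact ⟨hx, hπx⟩
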